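/- Let $d\ge 1$ be an integer, let $p\in(1,d]$ be real, and let $\Omega\subset\mathbb R^d$ be a bounded connected open set with $0\in\Omega$. Let $B_r$ be the ball with centre $0$ and radius $r$, and let $(\varepsilon_k)$ be a sequence of positive numbers converging to $0$. Let $W^{1,p}_0(\Omega)$ be the closure of $C^\infty_c(\Omega)$ in $W^{1,p}(\Omega)$. For $u\in W^{1,p}_0(\Omega)$, extended by $0$ outside $\Omega$, set $$F_k(u)=\frac1{|B_{\varepsilon_k}|}\int_\Omega\int_{B_{\varepsilon_k}}|u(x)-u(y)|^p\,dy\,dx+\int_\Omega|\nabla u(x)|^p\,dx .$$ Then for every $u\in L^p(\Omega)$ the function $t\mapsto\int_\Omega|u(x)-t|^p\,dx$ has a unique minimum point $m_p(u)$ on $\mathbb R$, and the functional $$F(u)=\int_\Omega|u(x)-m_p(u)|^p\,dx+\int_\Omega|\nabla u(x)|^p\,dx ,\qquad u\in W^{1,p}_0(\Omega),$$ is the $\Gamma$-limit of $(F_k)$ in the weak topology of $W^{1,p}_0(\Omega)$, both in the topological sense, that is, for every $u\in W^{1,p}_0(\Omega)$, $$F(u)=\sup_{U}\liminf_{k\to\infty}\inf_{v\in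 U}F_k(v)=\sup_{U}\limsup_{k\to\infty}\inf_{v\in U}F_k(v),$$ where $U$ runs over the neighbourhoods of $u$ in the weak topology, and in the sequential sense, that is, for every $u\in W^{1,p}_0(\Omega)$: 1. $F(u)\le\liminf_{k\to\infty}F_k(u_k)$ for every sequence $(u_k)$ converging to $u$ weakly in $W^{1,p}_0(\Omega)$; 2. there is a sequence $(u_k)$ converging to $u$ weakly in $W^{1,p}_0(\Omega)$ with $\limsup_{k\to\infty}F_k(u_k)\le F(u)$. -/

import Mathlib

open MeasureTheory Filter Topology Set
open scoped ENNReal ContDiff Gradient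

/-! ### Gamma-convergence in a topological space -/

section GammaConvergence

variable {X : Type*} [TopologicalSpace X]

/-- The `Γ`-lower limit `sup_{U ∈ 𝓝 x} liminf_k inf_{v ∈ U} F_k(v)`. -/
noncomputable def gammaLiminf (F : ℕ → X → ℝ≥0∞) (x : X) : ℝ≥0∞ :=
  ⨆ U ∈ 𝓝 x, liminf (fun k => ⨅ v ∈ U, F k v) atTop

/-- The `Γ`-upper limit `sup_{U ∈ 𝓝 x} limsup_k inf_{v ∈ U} F_k(v)`. -/
noncomputable def gammaLimsup (F : ℕ → X → ℝ≥0∞) (x : X) : ℝ≥0∞ :=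
  ⨆ U ∈ 𝓝 x, limsup (fun k => ⨅ v ∈ U, F k v) atTop

/-- `G` is the `Γ`-limit of `F_k` in the topology of `X`. -/
def IsGammaLimit (F : ℕ → X → ℝ≥0∞) (G : X → ℝ≥0∞) : Prop :=
  ∀ x, gammaLiminf F x = G x ∧ gammaLimsup F x = G x

/-- `G` is the sequential `Γ`-limit of `F_k`: the liminf inequality along every convergent
sequence, and existence of recovery sequences. -/
def IsSeqGammaLimit (F : ℕ → X → ℝ≥0∞) (G : X → ℝ≥0∞) : Prop :=
  ∀ x, (∀ u : ℕ → X, Tendsto u atTop (𝓝 x) → G x ≤ liminf (fun k => F k (u k)) atTop) ∧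
    ∃ u : ℕ → X, Tendsto u atTop (𝓝 x) ∧ limsup (fun k => F k (u k)) atTop ≤ G x

end GammaConvergence

/-! ### The Sobolev space `W^{1,p}_0(Ω)` -/

/-- An exponent `p > 1` is admissible for the normed space structure of `L^p`. -/
instance factOneLeOfReal (p : ℝ) [h : Fact (1 < p)] : Fact (1 ≤ ENNReal.ofReal p) :=
  ⟨ENNReal.one_le_ofReal.2 h.out.le⟩

/-- `φ ∈ C^∞_c(Ω)`. -/
structure IsTestFunction {d : ℕ} (Ω : Set (EuclideanSpace ℝ (Fin d)))
    (φ : EuclideanSpace ℝ (Fin d) → ℝ) : Prop where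
  smooth : ContDiff ℝ ∞ φ
  compact : HasCompactSupport φ
  support : tsupport φ ⊆ Ω

/-- The pairs `(φ, ∇φ)`, with `φ ∈ C^∞_c(Ω)`, in `L^p(Ω) × L^p(Ω; ℝ^d)`. -/
noncomputable def testGraph {d : ℕ} (Ω : Set (EuclideanSpace ℝ (Fin d))) (p : ℝ) [Fact (1 < p)] :
    Submodule ℝ (Lp ℝ (ENNReal.ofReal p) (volume.restrict Ω) ×
      Lp (EuclideanSpace ℝ (Fin d)) (ENNReal.ofReal p) (volume.restrict Ω)) where
  carrier := {w | ∃ φ, IsTestFunction Ω φ ∧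
    w.1 =ᵐ[volume.restrict Ω] φ ∧ w.2 =ᵐ[volume.restrict Ω] ∇ φ}
  zero_mem' := by
    refine ⟨fun _ => 0, ⟨contDiff_const, HasCompactSupport.zero, by simp [tsupport]⟩, ?_, ?_⟩
    · exact Lp.coeFn_zero _ _ _
    · filter_upwards [Lp.coeFn_zero (EuclideanSpace ℝ (Fin d)) (ENNReal.ofReal p)
        (volume.restrict Ω)] with x hx
      simpa [gradient] using hx
  add_mem' := by
    rintro w z ⟨φ, hφ, hw1, hw2⟩ ⟨ψ, hψ, hz1, hz2⟩
    refine ⟨φ + ψ, ⟨hφ.smooth.add hψ.smooth, hφ.compact.add hψ.compact,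
      (tsupport_add φ ψ).trans (union_subset hφ.support hψ.support)⟩, ?_, ?_⟩
    · filter_upwards [Lp.coeFn_add w.1 z.1, hw1, hz1] with x h h1 h2
      simp only [Prod.fst_add, h, Pi.add_apply, h1, h2]
    · filter_upwards [Lp.coeFn_add w.2 z.2, hw2, hz2] with x h h1 h2
      simp only [Prod.snd_add, h, Pi.add_apply, h1, h2, gradient]
      rw [fderiv_add (hφ.smooth.differentiable (by simp) x)
        (hψ.smooth.differentiable (by simp) x), map_add]
  smul_mem' := by
    rintro c w ⟨φ, hφ, hw1, hw2⟩
    refine ⟨c • φ, ⟨hφ.smooth.const_smul c, hφ.compact.mono (Function.support_const_smul_subset c φ),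
      (closure_mono (Function.support_const_smul_subset c φ)).trans hφ.support⟩, ?_, ?_⟩
    · filter_upwards [Lp.coeFn_smul c w.1, hw1] with x h h1
      simp only [Prod.smul_fst, h, Pi.smul_apply, h1]
    · filter_upwards [Lp.coeFn_smul c w.2, hw2] with x h h1
      simp only [Prod.smul_snd, h, Pi.smul_apply, h1, gradient]
      rw [fderiv_const_smul (hφ.smooth.differentiable (by simp) x)]
      simp

/-- `W^{1,p}_0(Ω)`: the closure of `C^∞_c(Ω)` in the Sobolev norm, an element `u` being recorded
as the pair `(u, ∇u)` of `L^p(Ω) × L^p(Ω; ℝ^d)`. By `SobolevZero.isWeakGradient` below the second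
entry is the weak gradient of the first. -/
noncomputable abbrev SobolevZero {d : ℕ} (Ω : Set (EuclideanSpace ℝ (Fin d))) (p : ℝ) [Fact (1 < p)] :
    Submodule ℝ (Lp ℝ (ENNReal.ofReal p) (volume.restrict Ω) ×
      Lp (EuclideanSpace ℝ (Fin d)) (ENNReal.ofReal p) (volume.restrict Ω)) :=
  (testGraph Ω p).topologicalClosure

/-- Every test function, with its classical gradient, belongs to `W^{1,p}_0(Ω)`. -/
theorem SobolevZero.exists_of_isTestFunction {d : ℕ} {Ω : Set (EuclideanSpace ℝ (Fin d))}
    {p : ℝ} [Fact (1 < p)] {φ : EuclideanSpace ℝ (Fin d) → ℝ} (hφ : IsTestFunction Ω φ) :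
    ∃ u : SobolevZero Ω p, u.1.1 =ᵐ[volume.restrict Ω] φ ∧ u.1.2 =ᵐ[volume.restrict Ω] ∇ φ := by
  have h1 : MemLp φ (ENNReal.ofReal p) (volume.restrict Ω) :=
    (hφ.smooth.continuous.memLp_of_hasCompactSupport hφ.compact).restrict Ω
  have hc : Continuous (∇ φ) := (InnerProductSpace.toDual ℝ _).symm.continuous.comp
    (hφ.smooth.continuous_fderiv (by simp))
  have hs : HasCompactSupport (∇ φ) :=
    (hφ.compact.fderiv (𝕜 := ℝ)).comp_left (g := (InnerProductSpace.toDual ℝ _).symm) (map_zero _)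
  have h2 : MemLp (∇ φ) (ENNReal.ofReal p) (volume.restrict Ω) :=
    (hc.memLp_of_hasCompactSupport hs).restrict Ω
  exact ⟨⟨(h1.toLp φ, h2.toLp _), Submodule.le_topologicalClosure _
    ⟨φ, hφ, h1.coeFn_toLp, h2.coeFn_toLp⟩⟩, h1.coeFn_toLp, h2.coeFn_toLp⟩

/-- `g` is the weak gradient of `u` on `Ω`. -/
def IsWeakGradient {d : ℕ} (Ω : Set (EuclideanSpace ℝ (Fin d)))
    (u : EuclideanSpace ℝ (Fin d) → ℝ)
    (g : EuclideanSpace ℝ (Fin d) → EuclideanSpace ℝ (Fin d)) : Prop :=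
  ∀ φ, IsTestFunction Ω φ → ∀ v : EuclideanSpace ℝ (Fin d),
    ∫ x in Ω, u x * inner ℝ (∇ φ x) v = -∫ x in Ω, φ x * inner ℝ (g x) v

theorem SobolevZero.isWeakGradient {d : ℕ} {Ω : Set (EuclideanSpace ℝ (Fin d))}
    {p : ℝ} [Fact (1 < p)] (u : SobolevZero Ω p) : IsWeakGradient Ω u.1.1 u.1.2 := by
  intro φ hφ v
  have hp : (1 : ℝ) < p := Fact.out
  have hpq := Real.HolderConjugate.conjExponent hp
  have := Real.HolderConjugate.ennrealOfReal hpq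
  have : Fact (1 ≤ ENNReal.ofReal p.conjExponent) := ⟨ENNReal.one_le_ofReal.2 hpq.symm.lt.le⟩
  have hφ1 := hφ.smooth.continuous
  have hφ2 : Continuous fun x => fderiv ℝ φ x v :=
    (hφ.smooth.continuous_fderiv (by simp)).clm_apply continuous_const
  have hφ3 : HasCompactSupport fun x => fderiv ℝ φ x v :=
    (hφ.compact.fderiv (𝕜 := ℝ)).comp_left
      (g := fun L : EuclideanSpace ℝ (Fin d) →L[ℝ] ℝ => L v) (by simp)
  have h1 : MemLp (fun x => fderiv ℝ φ x v) (ENNReal.ofReal p.conjExponent)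
    (volume.restrict Ω) := (hφ2.memLp_of_hasCompactSupport hφ3).restrict Ω
  have h2 : MemLp (fun x => φ x • v) (ENNReal.ofReal p.conjExponent) (volume.restrict Ω) :=
    ((hφ1.smul continuous_const).memLp_of_hasCompactSupport hφ.compact.smul_right).restrict Ω
  let A := (ContinuousLinearMap.mul ℝ ℝ).lpPairing (volume.restrict Ω)
    (ENNReal.ofReal p) (ENNReal.ofReal p.conjExponent)
  let B := (innerSL ℝ (E := EuclideanSpace ℝ (Fin d))).lpPairing (volume.restrict Ω)
    (ENNReal.ofReal p) (ENNReal.ofReal p.conjExponent)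
  have hA : ∀ w, A w (h1.toLp _) = ∫ x in Ω, w x * inner ℝ (∇ φ x) v := fun w => by
    rw [ContinuousLinearMap.lpPairing_eq_integral]
    refine integral_congr_ae ?_
    filter_upwards [h1.coeFn_toLp] with x hx
    simp [hx, inner_gradient_left]
  have hB : ∀ w, B w (h2.toLp _) = ∫ x in Ω, φ x * inner ℝ (w x) v := fun w => by
    rw [ContinuousLinearMap.lpPairing_eq_integral]
    refine integral_congr_ae ?_
    filter_upwards [h2.coeFn_toLp] with x hx
    rw [hx, innerSL_apply_apply, inner_smul_right]
  rw [← hA, ← hB]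
  have hcl : IsClosed {w : Lp ℝ (ENNReal.ofReal p) (volume.restrict Ω) ×
      Lp (EuclideanSpace ℝ (Fin d)) (ENNReal.ofReal p) (volume.restrict Ω) |
      A w.1 (h1.toLp _) = -B w.2 (h2.toLp _)} := by
    apply isClosed_eq
    · exact (A.continuous.comp continuous_fst).clm_apply continuous_const
    · exact ((B.continuous.comp continuous_snd).clm_apply continuous_const).neg
  refine (closure_minimal ?_ hcl) u.2
  rintro w ⟨ψ, hψ, hw1, hw2⟩
  simp only [mem_ofPred_eq, hA, hB]
  have e1 : ∫ x in Ω, w.1 x * inner ℝ (∇ φ x) v = ∫ x in Ω, ψ x * fderiv ℝ φ x v := by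
    refine integral_congr_ae ?_
    filter_upwards [hw1] with x hx
    simp [hx, inner_gradient_left]
  have e2 : ∫ x in Ω, φ x * inner ℝ (w.2 x) v = ∫ x in Ω, fderiv ℝ ψ x v * φ x := by
    refine integral_congr_ae ?_
    filter_upwards [hw2] with x hx
    simp [hx, inner_gradient_left, mul_comm]
  have hψ2 : Continuous fun x => fderiv ℝ ψ x v :=
    (hψ.smooth.continuous_fderiv (by simp)).clm_apply continuous_const
  rw [e1, e2,
    setIntegral_eq_integral_of_forall_compl_eq_zero fun x hx => by
      rw [image_eq_zero_of_notMem_tsupport fun h => hx (hψ.support h), zero_mul],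
    setIntegral_eq_integral_of_forall_compl_eq_zero fun x hx => by
      rw [image_eq_zero_of_notMem_tsupport fun h => hx (hφ.support h), mul_zero]]
  exact integral_mul_fderiv_eq_neg_fderiv_mul_of_integrable
    ((hψ2.mul hφ1).integrable_of_hasCompactSupport hφ.compact.mul_left)
    ((hψ.smooth.continuous.mul hφ2).integrable_of_hasCompactSupport hφ3.mul_left)
    ((hψ.smooth.continuous.mul hφ1).integrable_of_hasCompactSupport hφ.compact.mul_left)
    (fun x _ => hψ.smooth.differentiable (by simp) x)
    (fun x _ => hφ.smooth.differentiable (by simp) x)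

/-! ### The functionals -/

/-- `t` is a minimum point of `s ↦ ∫_Ω |u(x) - s|^p dx` on `ℝ`. -/
def IsPMean {d : ℕ} (Ω : Set (EuclideanSpace ℝ (Fin d))) (p : ℝ)
    (u : EuclideanSpace ℝ (Fin d) → ℝ) (t : ℝ) : Prop :=
  IsMinOn (fun s : ℝ => ∫⁻ x in Ω, ‖u x - s‖ₑ ^ p) univ t

/-- `m_p(u)`, a chosen minimum point of `t ↦ ∫_Ω |u(x) - t|^p dx`. -/
noncomputable def pMean {d : ℕ} (Ω : Set (EuclideanSpace ℝ (Fin d))) (p : ℝ)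
    (u : EuclideanSpace ℝ (Fin d) → ℝ) : ℝ :=
  Classical.epsilon (IsPMean Ω p u)

/-- `|B_r|⁻¹ ∫_Ω ∫_{B_r} |u(x) - u(y)|^p dy dx + ∫_Ω |∇u(x)|^p dx`, where `B_r` is the ball with
centre `0` and radius `r`, and `u` is extended by `0` outside `Ω`. -/
noncomputable def nonlocalEnergy {d : ℕ} (Ω : Set (EuclideanSpace ℝ (Fin d))) (p : ℝ)
    [Fact (1 < p)] (r : ℝ) (u : SobolevZero Ω p) : ℝ≥0∞ :=
  (volume (Metric.ball (0 : EuclideanSpace ℝ (Fin d)) r))⁻¹ *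
      (∫⁻ x in Ω, ∫⁻ y in Metric.ball (0 : EuclideanSpace ℝ (Fin d)) r,
        ‖u.1.1 x - Ω.indicator u.1.1 y‖ₑ ^ p) +
    ∫⁻ x in Ω, ‖u.1.2 x‖ₑ ^ p

/-- `∫_Ω |u(x) - m_p(u)|^p dx + ∫_Ω |∇u(x)|^p dx`. -/
noncomputable def limitEnergy {d : ℕ} (Ω : Set (EuclideanSpace ℝ (Fin d))) (p : ℝ)
    [Fact (1 < p)] (u : SobolevZero Ω p) : ℝ≥0∞ :=
  (∫⁻ x in Ω, ‖u.1.1 x - pMean Ω p u.1.1‖ₑ ^ p) + ∫⁻ x in Ω, ‖u.1.2 x‖ₑ ^ p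

/-!
The proof rests on two observations.

*Lower bound.* After an exchange of integrals, the nonlocal term of `F_k(u)` is the average over
`y ∈ B_{ε_k}` of `∫_Ω |u(x) - u(y)|^p dx`, so it is at least `min_t ∫_Ω |u(x) - t|^p dx`. Hence
`F ≤ F_k` everywhere (`limitEnergy_le_nonlocalEnergy`). The functional `F` is the sum of the `p`-th
powers of the `L^p` distance from `u` to the constants and of the `L^p` norm of `∇u`; it is convex
and norm continuous, hence weakly lower semicontinuous (`lowerSemicontinuous_limitEnergy`). This
gives both lower inequalities, without any compactness.

*Recovery.* Since `1 < p ≤ d`, points have zero `p`-capacity: averaging `N` bump functions at the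
scales `1, 4⁻¹, 4⁻², …`, whose gradients have disjoint supports and bounded energies, gives a
function equal to `1` near `0` with gradient energy `O(N^{1-p})` (`exists_cutoff_eLpNorm_le`).
With such cutoffs, and by density of the test functions, every `u` is a norm limit of elements `w`
that are equal to `m_p(u)` near `0` (`exists_edist_le_ae_eq_near_zero`). For these, as soon as
`ε_k` is small, `F_k(w) = ∫_Ω |w - m_p(u)|^p + ∫_Ω |∇w|^p`, which is close to `F(u)`; a diagonal
sequence then recovers `F(u)`.

Existence of `m_p(u)` follows from coercivity and continuity of `t ↦ ‖u - t‖` in `L^p(Ω)`, and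
uniqueness from the strict convexity of `|·|^p`.
-/

/-! ### Gamma-convergence from a pointwise lower bound and approximate recovery -/

section GammaConvergence

variable {X : Type*} [TopologicalSpace X]

theorem gammaLiminf_le_gammaLimsup (F : ℕ → X → ℝ≥0∞) (x : X) :
    gammaLiminf F x ≤ gammaLimsup F x :=
  iSup₂_mono fun _ _ => liminf_le_limsup

theorem gammaLimsup_le_limsup (F : ℕ → X → ℝ≥0∞) {x : X} {u : ℕ → X}
    (hu : Tendsto u atTop (𝓝 x)) : gammaLimsup F x ≤ limsup (fun k => F k (u k)) atTop := by
  refine iSup₂_le fun U hU => limsup_le_limsup ?_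
  filter_upwards [hu hU] with k hk using iInf₂_le (u k) hk

theorem LowerSemicontinuous.le_gammaLiminf {F : ℕ → X → ℝ≥0∞} {G : X → ℝ≥0∞}
    (hG : LowerSemicontinuous G) (hGF : ∀ k x, G x ≤ F k x) (x : X) : G x ≤ gammaLiminf F x := by
  refine le_of_forall_lt fun c hc => ?_
  obtain ⟨b, hcb, hb⟩ := exists_between hc
  refine hcb.trans_le (le_iSup₂_of_le {y | b < G y} (hG x b hb) ?_)
  exact le_liminf_of_le (by isBoundedDefault)
    (Eventually.of_forall fun k => le_iInf₂ fun v hv => (le_of_lt hv).trans (hGF k v))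

theorem LowerSemicontinuous.le_liminf_of_tendsto {F : ℕ → X → ℝ≥0∞} {G : X → ℝ≥0∞}
    (hG : LowerSemicontinuous G) (hGF : ∀ k x, G x ≤ F k x) {x : X} {u : ℕ → X}
    (hu : Tendsto u atTop (𝓝 x)) : G x ≤ liminf (fun k => F k (u k)) atTop := by
  refine le_of_forall_lt fun c hc => ?_
  obtain ⟨b, hcb, hb⟩ := exists_between hc
  refine hcb.trans_le (le_liminf_of_le (by isBoundedDefault) ?_)
  filter_upwards [hu (hG x b hb)] with k hk using (le_of_lt hk).trans (hGF k (u k))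

/-- A lower semicontinuous lower bound that is attained by recovery sequences is the `Γ`-limit, both
in the topological and in the sequential sense. -/
theorem isGammaLimit_and_isSeqGammaLimit {F : ℕ → X → ℝ≥0∞} {G : X → ℝ≥0∞}
    (hG : LowerSemicontinuous G) (hGF : ∀ k x, G x ≤ F k x)
    (hrec : ∀ x, ∃ u : ℕ → X, Tendsto u atTop (𝓝 x) ∧
      limsup (fun k => F k (u k)) atTop ≤ G x) : IsGammaLimit F G ∧ IsSeqGammaLimit F G := by
  refine ⟨fun x => ?_, fun x => ⟨fun u hu => hG.le_liminf_of_tendsto hGF hu, hrec x⟩⟩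
  obtain ⟨u, hu, hle⟩ := hrec x
  have h1 := hG.le_gammaLiminf hGF x
  have h2 := gammaLiminf_le_gammaLimsup F x
  have h3 := (gammaLimsup_le_limsup F hu).trans hle
  exact ⟨le_antisymm (h2.trans h3) h1, le_antisymm h3 (h1.trans h2)⟩

end GammaConvergence

/-- If points arbitrarily close to `x` have energies eventually at most `G + δ`, with `δ`
arbitrarily small, then a diagonal sequence recovers the value `G` at `x`. -/
theorem exists_tendsto_limsup_le_of_approx {E : Type*} [PseudoEMetricSpace E] (F : ℕ → E → ℝ≥0∞)
    (x : E) (G : ℝ≥0∞)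
    (h : ∀ δ : ℝ≥0∞, 0 < δ → ∃ w, edist w x ≤ δ ∧ ∀ᶠ k in atTop, F k w ≤ G + δ) :
    ∃ u : ℕ → E, Tendsto u atTop (𝓝 x) ∧ limsup (fun k => F k (u k)) atTop ≤ G := by
  rcases eq_or_ne G ∞ with rfl | hG
  · exact ⟨fun _ => x, tendsto_const_nhds, le_top⟩
  -- The terms `u k` nearly minimize this penalized energy, whose infimum tends to `0`.
  set J : ℕ → E → ℝ≥0∞ := fun k w => edist w x + (F k w - G) with hJ
  have hinf : Tendsto (fun k => ⨅ w, J k w) atTop (𝓝 0) := by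
    rw [ENNReal.tendsto_nhds_zero]
    intro δ hδ
    obtain ⟨w, hw, hk⟩ := h (δ / 2) (ENNReal.half_pos hδ.ne')
    filter_upwards [hk] with k hk
    refine (iInf_le _ w).trans ?_
    calc J k w ≤ δ / 2 + δ / 2 := add_le_add hw (tsub_le_iff_left.2 hk)
      _ = δ := ENNReal.add_halves δ
  have hu : ∀ k : ℕ, ∃ w, J k w ≤ (⨅ w, J k w) + ((k : ℝ≥0∞) + 1)⁻¹ := by
    intro k
    rcases eq_or_ne (⨅ w, J k w) ∞ with ht | ht
    · exact ⟨x, by simp [ht]⟩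
    · obtain ⟨w, hw⟩ := iInf_lt_iff.1 (ENNReal.lt_add_right ht
        (b := ((k : ℝ≥0∞) + 1)⁻¹) (by simp))
      exact ⟨w, hw.le⟩
  choose u hu using hu
  have hJu : Tendsto (fun k => J k (u k)) atTop (𝓝 0) := by
    refine tendsto_of_tendsto_of_tendsto_of_le_of_le tendsto_const_nhds ?_ (fun _ => zero_le) hu
    have h0 : Tendsto (fun k : ℕ => ((k : ℝ≥0∞) + 1)⁻¹) atTop (𝓝 0) := by
      simpa using (tendsto_add_atTop_iff_nat 1).2 ENNReal.tendsto_inv_nat_nhds_zero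
    simpa using hinf.add h0
  refine ⟨u, tendsto_iff_edist_tendsto_0.2 ?_, ?_⟩
  · exact tendsto_of_tendsto_of_tendsto_of_le_of_le tendsto_const_nhds hJu
      (fun _ => zero_le) (fun _ => le_self_add)
  · -- Truncated subtraction still gives `F k (u k) ≤ G + J k (u k)`.
    have hle : limsup (fun k => F k (u k)) atTop ≤ limsup (fun k => G + J k (u k)) atTop :=
      limsup_le_limsup (Eventually.of_forall fun k =>
        tsub_le_iff_left.1 (le_add_self (a := F k (u k) - G)))
    refine hle.trans_eq ?_
    simpa using (tendsto_const_nhds (x := G).add hJu).limsup_eq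

/-- A weakly lower semicontinuous lower bound that is approximately attained at points arbitrarily
close in norm is the `Γ`-limit in the weak topology, in both senses. -/
theorem isGammaLimit_and_isSeqGammaLimit_weakSpace {E : Type*} [NormedAddCommGroup E]
    [NormedSpace ℝ E] {F : ℕ → E → ℝ≥0∞} {G : E → ℝ≥0∞}
    (hG : LowerSemicontinuous fun u : WeakSpace ℝ E => G ((toWeakSpace ℝ E).symm u))
    (hGF : ∀ k x, G x ≤ F k x)
    (happrox : ∀ x, ∀ δ : ℝ≥0∞, 0 < δ → ∃ w, edist w x ≤ δ ∧ ∀ᶠ k in atTop, F k w ≤ G x + δ) :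
    IsGammaLimit (X := WeakSpace ℝ E) (fun k u => F k ((toWeakSpace ℝ E).symm u))
      (fun u => G ((toWeakSpace ℝ E).symm u)) ∧
    IsSeqGammaLimit (X := WeakSpace ℝ E) (fun k u => F k ((toWeakSpace ℝ E).symm u))
      (fun u => G ((toWeakSpace ℝ E).symm u)) := by
  refine isGammaLimit_and_isSeqGammaLimit hG (fun k u => hGF k _) fun u => ?_
  obtain ⟨v, hv, hle⟩ := exists_tendsto_limsup_le_of_approx F ((toWeakSpace ℝ E).symm u) _
    (happrox _)
  refine ⟨fun k => toWeakSpace ℝ E (v k), ?_, by simpa using hle⟩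
  exact ((toWeakSpaceCLM ℝ E).continuous.tendsto _).comp hv

/-! ### Convexity and weak lower semicontinuity -/

/-- A convex, norm continuous function is lower semicontinuous for the weak topology. -/
theorem ConvexOn.lowerSemicontinuous_toWeakSpace_symm {E : Type*} [NormedAddCommGroup E]
    [NormedSpace ℝ E] {g : E → ℝ} (hg : ConvexOn ℝ univ g) (hc : Continuous g) :
    LowerSemicontinuous fun x : WeakSpace ℝ E => g ((toWeakSpace ℝ E).symm x) := by
  rw [lowerSemicontinuous_iff_isClosed_preimage]
  intro y
  have hconv : Convex ℝ {x | g x ≤ y} := by simpa using hg.convex_le y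
  have hcl : IsClosed {x | g x ≤ y} := isClosed_le hc continuous_const
  have himg := hconv.toWeakSpace_closure ℝ
  rw [hcl.closure_eq] at himg
  have heq : (fun x : WeakSpace ℝ E => g ((toWeakSpace ℝ E).symm x)) ⁻¹' Iic y =
      toWeakSpace ℝ E '' {x | g x ≤ y} := by
    rw [LinearEquiv.image_eq_preimage_symm]
    rfl
  rw [heq, himg]
  exact isClosed_closure

theorem ConvexOn.rpow_of_nonneg {E : Type*} [AddCommGroup E] [Module ℝ E] {g : E → ℝ} {p : ℝ}
    (hg : ConvexOn ℝ univ g) (h0 : ∀ x, 0 ≤ g x) (hp : 1 ≤ p) :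
    ConvexOn ℝ univ fun x => g x ^ p := by
  refine ⟨convex_univ, fun u _ v _ a b ha hb hab => ?_⟩
  refine (Real.rpow_le_rpow (h0 _) (hg.2 (mem_univ u) (mem_univ v) ha hb hab)
    (by linarith)).trans ?_
  exact (convexOn_rpow hp).2 (h0 u) (h0 v) ha hb hab

/-! ### The `p`-mean -/

theorem abs_add_div_two_rpow_lt {p : ℝ} (hp : 1 < p) {a b : ℝ} (hab : a ≠ b) :
    |(a + b) / 2| ^ p < (|a| ^ p + |b| ^ p) / 2 := by
  have hp0 : 0 < p := zero_lt_one.trans hp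
  have hle : |(a + b) / 2| ≤ (|a| + |b|) / 2 := by
    rw [abs_div, abs_two]
    linarith [abs_add_le a b]
  by_cases h : |a| = |b|
  · have hb : a = -b := (abs_eq_abs.1 h).resolve_left hab
    have hb0 : b ≠ 0 := by
      rintro rfl
      exact hab (by simpa using hb)
    have : 0 < |b| ^ p := Real.rpow_pos_of_pos (abs_pos.2 hb0) p
    rw [hb]
    simpa [Real.zero_rpow hp0.ne'] using this
  · have hconv := (strictConvexOn_rpow hp).2 (abs_nonneg a) (abs_nonneg b) h
      (show (0 : ℝ) < 1 / 2 by norm_num) (show (0 : ℝ) < 1 / 2 by norm_num) (by norm_num)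
    simp only [smul_eq_mul] at hconv
    calc |(a + b) / 2| ^ p ≤ (1 / 2 * |a| + 1 / 2 * |b|) ^ p :=
          Real.rpow_le_rpow (abs_nonneg _) (by linarith) hp0.le
      _ < 1 / 2 * |a| ^ p + 1 / 2 * |b| ^ p := hconv
      _ = _ := by ring

section PMean

variable {α E : Type*} {m : MeasurableSpace α} {μ : Measure α} [NormedAddCommGroup E] {p : ℝ}
  [hp : Fact (1 < p)]

theorem lintegral_enorm_rpow_eq_ofReal_norm_rpow (f : Lp E (ENNReal.ofReal p) μ) :
    ∫⁻ x, ‖f x‖ₑ ^ p ∂μ = ENNReal.ofReal (‖f‖ ^ p) := by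
  have hp0 : 0 < p := zero_lt_one.trans hp.out
  rw [← ENNReal.ofReal_rpow_of_nonneg (norm_nonneg _) hp0.le, ofReal_norm, Lp.enorm_def,
    eLpNorm_eq_lintegral_rpow_enorm_toReal (by simpa using hp0) ENNReal.ofReal_ne_top,
    ENNReal.toReal_ofReal hp0.le, ← ENNReal.rpow_mul, one_div_mul_cancel hp0.ne', ENNReal.rpow_one]

variable [IsFiniteMeasure μ]

theorem lintegral_enorm_sub_rpow_eq_ofReal (f : Lp ℝ (ENNReal.ofReal p) μ) (t : ℝ) :
    ∫⁻ x, ‖f x - t‖ₑ ^ p ∂μ =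
      ENNReal.ofReal (‖f - Lp.const (ENNReal.ofReal p) μ t‖ ^ p) := by
  rw [← lintegral_enorm_rpow_eq_ofReal_norm_rpow]
  refine lintegral_congr_ae ?_
  filter_upwards [Lp.coeFn_sub f (Lp.const (ENNReal.ofReal p) μ t),
    Lp.coeFn_const (ENNReal.ofReal p) μ t] with x h1 h2
  rw [h1, Pi.sub_apply, h2, Function.const_apply]

theorem lintegral_enorm_sub_rpow_le_iff (f : Lp ℝ (ENNReal.ofReal p) μ) (s t : ℝ) :
    ∫⁻ x, ‖f x - s‖ₑ ^ p ∂μ ≤ ∫⁻ x, ‖f x - t‖ₑ ^ p ∂μ ↔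
      ‖f - Lp.const (ENNReal.ofReal p) μ s‖ ≤ ‖f - Lp.const (ENNReal.ofReal p) μ t‖ := by
  have hp0 : 0 < p := zero_lt_one.trans hp.out
  rw [lintegral_enorm_sub_rpow_eq_ofReal, lintegral_enorm_sub_rpow_eq_ofReal,
    ENNReal.ofReal_le_ofReal_iff (by positivity),
    Real.rpow_le_rpow_iff (norm_nonneg _) (norm_nonneg _) hp0]

theorem continuous_Lp_const : Continuous fun t : ℝ => Lp.const (ENNReal.ofReal p) μ t :=
  (Lp.constL (ENNReal.ofReal p) μ ℝ (E := ℝ)).continuous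

theorem exists_forall_norm_sub_const_le [NeZero μ] (f : Lp ℝ (ENNReal.ofReal p) μ) :
    ∃ t : ℝ, ∀ s : ℝ, ‖f - Lp.const (ENNReal.ofReal p) μ t‖ ≤
      ‖f - Lp.const (ENNReal.ofReal p) μ s‖ := by
  have hp0 : 0 < p := zero_lt_one.trans hp.out
  refine Continuous.exists_forall_le (continuous_const.sub continuous_Lp_const).norm ?_
  have hc : 0 < μ.real univ ^ (1 / (ENNReal.ofReal p).toReal) :=
    Real.rpow_pos_of_pos measureReal_univ_pos _
  have h1 : Tendsto (fun t : ℝ => ‖t‖ * μ.real univ ^ (1 / (ENNReal.ofReal p).toReal) + -‖f‖)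
      (cocompact ℝ) atTop :=
    tendsto_atTop_add_const_right _ _ ((tendsto_norm_cocompact_atTop).atTop_mul_const hc)
  refine tendsto_atTop_mono (fun t => ?_) h1
  rw [← Lp.norm_const (ENNReal.ofReal p) μ t (by simpa using hp0), norm_sub_rev]
  simpa [sub_eq_add_neg] using norm_sub_norm_le (Lp.const (ENNReal.ofReal p) μ t) f

/-- Uniqueness of the `p`-mean: by strict convexity, the midpoint of two distinct minimum points
would have a smaller integral. -/
theorem eq_of_forall_norm_sub_const_le [NeZero μ] {f : Lp ℝ (ENNReal.ofReal p) μ} {s t : ℝ}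
    (hs : ∀ r : ℝ, ‖f - Lp.const (ENNReal.ofReal p) μ s‖ ≤
      ‖f - Lp.const (ENNReal.ofReal p) μ r‖)
    (ht : ∀ r : ℝ, ‖f - Lp.const (ENNReal.ofReal p) μ t‖ ≤
      ‖f - Lp.const (ENNReal.ofReal p) μ r‖) : s = t := by
  have hp0 : 0 < p := zero_lt_one.trans hp.out
  by_contra hst
  have henorm : ∀ a : ℝ, ‖a‖ₑ ^ p = ENNReal.ofReal (|a| ^ p) := fun a => by
    rw [← ENNReal.ofReal_rpow_of_nonneg (abs_nonneg _) hp0.le, ← Real.norm_eq_abs, ofReal_norm]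
  have hmeas : ∀ r : ℝ, Measurable fun x => ‖f x - r‖ₑ ^ p := fun r =>
    (((Lp.stronglyMeasurable f).measurable.sub_const r).enorm).pow_const p
  have hlt : ∫⁻ x, ‖f x - (s + t) / 2‖ₑ ^ p + ‖f x - (s + t) / 2‖ₑ ^ p ∂μ <
      ∫⁻ x, ‖f x - s‖ₑ ^ p + ‖f x - t‖ₑ ^ p ∂μ := by
    refine lintegral_strict_mono (NeZero.ne μ) ((hmeas s).add (hmeas t)).aemeasurable ?_
      (Eventually.of_forall fun x => ?_)
    · rw [lintegral_add_left (hmeas _), lintegral_enorm_sub_rpow_eq_ofReal]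
      simp
    · have h := abs_add_div_two_rpow_lt hp.out (a := f x - s) (b := f x - t)
        (fun h => hst (by linarith))
      rw [show (f x - s + (f x - t)) / 2 = f x - (s + t) / 2 by ring] at h
      simp only [henorm]
      rw [← ENNReal.ofReal_add (by positivity) (by positivity),
        ← ENNReal.ofReal_add (by positivity) (by positivity)]
      exact (ENNReal.ofReal_lt_ofReal_iff_of_nonneg (by positivity)).2 (by linarith)
  rw [lintegral_add_left (hmeas _), lintegral_add_left (hmeas _)] at hlt
  exact hlt.not_ge (add_le_add ((lintegral_enorm_sub_rpow_le_iff f _ _).2 (hs _))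
    ((lintegral_enorm_sub_rpow_le_iff f _ _).2 (ht _)))

end PMean

/-! ### The limit energy and the nonlocal energies -/

section LimitEnergy

variable {d : ℕ} {Ω : Set (EuclideanSpace ℝ (Fin d))} {p : ℝ} [hp : Fact (1 < p)]
  [IsFiniteMeasure (volume.restrict Ω)]

theorem isPMean_iff (u : Lp ℝ (ENNReal.ofReal p) (volume.restrict Ω)) (t : ℝ) :
    IsPMean Ω p u t ↔ ∀ s : ℝ,
      ‖u - Lp.const (ENNReal.ofReal p) (volume.restrict Ω) t‖ ≤
        ‖u - Lp.const (ENNReal.ofReal p) (volume.restrict Ω) s‖ := by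
  simp only [IsPMean, isMinOn_iff, mem_univ, true_imp_iff, lintegral_enorm_sub_rpow_le_iff]

/-- The distance in `L^p(Ω)` from `u` to the constant functions, written as the distance to the
nearest one, the `p`-mean of `u`. -/
noncomputable def distConst (u : Lp ℝ (ENNReal.ofReal p) (volume.restrict Ω)) : ℝ :=
  ‖u - Lp.const (ENNReal.ofReal p) (volume.restrict Ω) (pMean Ω p u)‖

theorem limitEnergy_eq_ofReal (u : SobolevZero Ω p) :
    limitEnergy Ω p u = ENNReal.ofReal (distConst u.1.1 ^ p + ‖u.1.2‖ ^ p) := by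
  rw [limitEnergy, lintegral_enorm_sub_rpow_eq_ofReal, lintegral_enorm_rpow_eq_ofReal_norm_rpow,
    ← ENNReal.ofReal_add (by positivity) (by positivity)]
  rfl

/-- If `u` is equal to `t` in a ball that contains `B_r`, the nonlocal term is exactly
`∫_Ω |u(x) - t|^p dx`. -/
theorem nonlocalEnergy_eq_of_ae_eq {ρ r t : ℝ} (hr : 0 < r) (hrρ : r ≤ ρ)
    (hρ : Metric.ball 0 ρ ⊆ Ω) {u : SobolevZero Ω p}
    (hu : ∀ᵐ x ∂volume.restrict (Metric.ball 0 ρ), u.1.1 x = t) :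
    nonlocalEnergy Ω p r u = ENNReal.ofReal
      (‖u.1.1 - Lp.const (ENNReal.ofReal p) (volume.restrict Ω) t‖ ^ p + ‖u.1.2‖ ^ p) := by
  have hsub := Metric.ball_subset_ball (x := (0 : EuclideanSpace ℝ (Fin d))) hrρ
  have hinner : ∀ x, ∫⁻ y in Metric.ball (0 : EuclideanSpace ℝ (Fin d)) r,
      ‖u.1.1 x - Ω.indicator u.1.1 y‖ₑ ^ p =
        ‖u.1.1 x - t‖ₑ ^ p * volume (Metric.ball (0 : EuclideanSpace ℝ (Fin d)) r) := by
    intro x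
    rw [← setLIntegral_const]
    refine lintegral_congr_ae ?_
    filter_upwards [ae_restrict_of_ae_restrict_of_subset hsub hu,
      ae_restrict_mem measurableSet_ball] with y hy hyr
    rw [indicator_of_mem (hρ (hsub hyr)), hy]
  have hB0 : volume (Metric.ball (0 : EuclideanSpace ℝ (Fin d)) r) ≠ 0 :=
    (Metric.measure_ball_pos volume 0 hr).ne'
  rw [nonlocalEnergy, lintegral_congr hinner, lintegral_mul_const' _ _ measure_ball_lt_top.ne,
    mul_left_comm, ENNReal.inv_mul_cancel hB0 measure_ball_lt_top.ne, mul_one,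
    lintegral_enorm_sub_rpow_eq_ofReal, lintegral_enorm_rpow_eq_ofReal_norm_rpow,
    ← ENNReal.ofReal_add (by positivity) (by positivity)]

variable [NeZero (volume.restrict Ω)]

theorem isPMean_pMean (u : Lp ℝ (ENNReal.ofReal p) (volume.restrict Ω)) :
    IsPMean Ω p u (pMean Ω p u) := by
  obtain ⟨t, ht⟩ := exists_forall_norm_sub_const_le u
  exact Classical.epsilon_spec ⟨t, (isPMean_iff u t).2 ht⟩

theorem isPMean_iff_eq_pMean (u : Lp ℝ (ENNReal.ofReal p) (volume.restrict Ω)) (t : ℝ) :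
    IsPMean Ω p u t ↔ t = pMean Ω p u := by
  refine ⟨fun h => ?_, fun h => h ▸ isPMean_pMean u⟩
  exact eq_of_forall_norm_sub_const_le ((isPMean_iff u _).1 h)
    ((isPMean_iff u _).1 (isPMean_pMean u))

theorem distConst_le (u : Lp ℝ (ENNReal.ofReal p) (volume.restrict Ω)) (t : ℝ) :
    distConst u ≤ ‖u - Lp.const (ENNReal.ofReal p) (volume.restrict Ω) t‖ :=
  (isPMean_iff u _).1 (isPMean_pMean u) t

theorem convexOn_distConst :
    ConvexOn ℝ univ (distConst : Lp ℝ (ENNReal.ofReal p) (volume.restrict Ω) → ℝ) := by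
  refine ⟨convex_univ, fun u _ v _ a b ha hb _ => ?_⟩
  refine (distConst_le _ (a * pMean Ω p u + b * pMean Ω p v)).trans ?_
  have hc : Lp.const (ENNReal.ofReal p) (volume.restrict Ω) (a * pMean Ω p u + b * pMean Ω p v) =
      a • Lp.const (ENNReal.ofReal p) (volume.restrict Ω) (pMean Ω p u) +
        b • Lp.const (ENNReal.ofReal p) (volume.restrict Ω) (pMean Ω p v) :=
    (map_add (Lp.constL (ENNReal.ofReal p) (volume.restrict Ω) ℝ (E := ℝ)) _ _).trans
      (congrArg₂ (· + ·) (map_smul (Lp.constL (ENNReal.ofReal p) (volume.restrict Ω) ℝ) a _)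
        (map_smul (Lp.constL (ENNReal.ofReal p) (volume.restrict Ω) ℝ) b _))
  rw [hc, show ∀ x y z w : Lp ℝ (ENNReal.ofReal p) (volume.restrict Ω),
    x + y - (z + w) = (x - z) + (y - w) from fun _ _ _ _ => by abel, ← smul_sub, ← smul_sub]
  refine (norm_add_le _ _).trans (le_of_eq ?_)
  rw [norm_smul, norm_smul, Real.norm_of_nonneg ha, Real.norm_of_nonneg hb]
  rfl

theorem lipschitzWith_distConst : LipschitzWith 1
    (distConst : Lp ℝ (ENNReal.ofReal p) (volume.restrict Ω) → ℝ) := by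
  refine LipschitzWith.of_le_add fun u v => ?_
  refine (distConst_le u (pMean Ω p v)).trans ?_
  rw [dist_eq_norm, add_comm]
  refine le_trans (le_of_eq ?_) (norm_add_le _ _)
  congr 1
  abel

theorem lowerSemicontinuous_limitEnergy :
    LowerSemicontinuous fun u : WeakSpace ℝ (SobolevZero Ω p) =>
      limitEnergy Ω p ((toWeakSpace ℝ (SobolevZero Ω p)).symm u) := by
  have hp0 : 0 < p := zero_lt_one.trans hp.out
  have hconv : ConvexOn ℝ univ fun u : SobolevZero Ω p => distConst u.1.1 ^ p + ‖u.1.2‖ ^ p := by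
    refine ConvexOn.add ?_ ?_
    · exact ((convexOn_distConst (Ω := Ω) (p := p)).comp_linearMap
        ((LinearMap.fst ℝ _ _).comp (SobolevZero Ω p).subtype)).rpow_of_nonneg
          (fun _ => norm_nonneg _) hp.out.le
    · exact ((convexOn_univ_norm (E := Lp (EuclideanSpace ℝ (Fin d)) (ENNReal.ofReal p)
        (volume.restrict Ω))).comp_linearMap
        ((LinearMap.snd ℝ _ _).comp (SobolevZero Ω p).subtype)).rpow_of_nonneg
          (fun _ => norm_nonneg _) hp.out.le
  have hcont : Continuous fun u : SobolevZero Ω p => distConst u.1.1 ^ p + ‖u.1.2‖ ^ p := by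
    refine Continuous.add ?_ ?_
    · exact (lipschitzWith_distConst.continuous.comp
        (continuous_fst.comp continuous_subtype_val)).rpow_const fun _ => Or.inr hp0.le
    · exact ((continuous_snd.comp continuous_subtype_val).norm).rpow_const
        fun _ => Or.inr hp0.le
  simp only [limitEnergy_eq_ofReal]
  exact ENNReal.continuous_ofReal.comp_lowerSemicontinuous
    (hconv.lowerSemicontinuous_toWeakSpace_symm hcont) fun _ _ h => ENNReal.ofReal_le_ofReal h

/-- After an exchange of the integrals, the nonlocal term is an average over `y` of
`∫_Ω |u(x) - t|^p dx` with `t = u(y)`, hence is at least the minimum of this integral over `t`. -/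
theorem limitEnergy_le_nonlocalEnergy (hΩ : MeasurableSet Ω) {r : ℝ} (hr : 0 < r)
    (u : SobolevZero Ω p) : limitEnergy Ω p u ≤ nonlocalEnergy Ω p r u := by
  refine add_le_add_left ?_ _
  have hu : Measurable u.1.1 := (Lp.stronglyMeasurable u.1.1).measurable
  rw [lintegral_lintegral_swap]
  swap
  · exact (((hu.comp measurable_fst).sub ((hu.indicator hΩ).comp measurable_snd)).enorm.pow_const
      p).aemeasurable
  have hB0 : volume (Metric.ball (0 : EuclideanSpace ℝ (Fin d)) r) ≠ 0 :=
    (Metric.measure_ball_pos volume 0 hr).ne'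
  calc ∫⁻ x in Ω, ‖u.1.1 x - pMean Ω p u.1.1‖ₑ ^ p
      = (volume (Metric.ball (0 : EuclideanSpace ℝ (Fin d)) r))⁻¹ *
          ∫⁻ _ in Metric.ball (0 : EuclideanSpace ℝ (Fin d)) r,
            ∫⁻ x in Ω, ‖u.1.1 x - pMean Ω p u.1.1‖ₑ ^ p := by
        rw [setLIntegral_const, mul_comm, mul_assoc,
          ENNReal.mul_inv_cancel hB0 measure_ball_lt_top.ne, mul_one]
    _ ≤ _ := by
        refine mul_le_mul_right (lintegral_mono fun y => ?_) _
        exact isPMean_pMean u.1.1 (mem_univ _)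

end LimitEnergy

/-! ### Points have zero `p`-capacity -/

section Capacity

theorem eLpNorm_ofReal_le_of_lintegral_le {α F : Type*} {m : MeasurableSpace α} {μ : Measure α}
    [NormedAddCommGroup F] {p : ℝ} (hp : 0 < p) {f : α → F} {δ : ℝ≥0∞}
    (hf : ∫⁻ x, ‖f x‖ₑ ^ p ∂μ ≤ δ ^ p) : eLpNorm f (ENNReal.ofReal p) μ ≤ δ := by
  rw [eLpNorm_eq_lintegral_rpow_enorm_toReal (by simpa using hp) ENNReal.ofReal_ne_top,
    ENNReal.toReal_ofReal hp.le, one_div]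
  exact (ENNReal.rpow_inv_le_iff hp).2 hf

theorem enorm_sum_rpow_le_of_subsingleton_ne_zero {ι F : Type*} [NormedAddCommGroup F] {p : ℝ}
    (hp : 0 < p) (s : Finset ι) (v : ι → F)
    (hv : ∀ i ∈ s, ∀ j ∈ s, v i ≠ 0 → v j ≠ 0 → i = j) :
    ‖∑ i ∈ s, v i‖ₑ ^ p ≤ ∑ i ∈ s, ‖v i‖ₑ ^ p := by
  by_cases h : ∃ i ∈ s, v i ≠ 0
  · obtain ⟨i, hi, hvi⟩ := h
    rw [Finset.sum_eq_single_of_mem i hi fun j hj hji =>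
      by_contra fun hvj => hji (hv j hj i hi hvj hvi)]
    exact Finset.single_le_sum (f := fun i => ‖v i‖ₑ ^ p) (fun _ _ => zero_le) hi
  · push Not at h
    rw [Finset.sum_eq_zero h]
    simp [hp]

variable {E : Type*} [NormedAddCommGroup E] [InnerProductSpace ℝ E] [FiniteDimensional ℝ E]

/-- A smooth function equal to `1` on the unit ball and vanishing outside the ball of
radius `2`. -/
noncomputable def unitBump (E : Type*) [NormedAddCommGroup E] [InnerProductSpace ℝ E] :
    ContDiffBump (0 : E) where
  rIn := 1
  rOut := 2
  rIn_pos := one_pos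
  rIn_lt_rOut := one_lt_two

theorem contDiff_unitBump_smul (s : ℝ) : ContDiff ℝ ∞ fun x : E => unitBump E (s • x) :=
  (unitBump E).contDiff.comp (contDiff_const_smul s)

theorem norm_mem_Icc_of_fderiv_unitBump_ne_zero {x : E} (hx : fderiv ℝ (unitBump E) x ≠ 0) :
    ‖x‖ ∈ Icc 1 2 := by
  constructor
  · by_contra! h
    refine hx ?_
    have : unitBump E =ᶠ[𝓝 x] fun _ => (1 : ℝ) := by
      filter_upwards [Metric.isOpen_ball.mem_nhds
        (show x ∈ Metric.ball (0 : E) 1 by simpa using h)] with y hy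
      exact (unitBump E).one_of_mem_closedBall (Metric.ball_subset_closedBall hy)
    rw [this.fderiv_eq]
    simp
  · have := support_fderiv_subset ℝ hx
    rw [(unitBump E).tsupport_eq] at this
    simpa [unitBump] using this

/-- The average of the `N` functions `x ↦ unitBump (s 4^i x)`, `i < N`. The gradient of the `i`-th
one lives in the annulus `1 ≤ s 4^i ‖x‖ ≤ 2`, and the ratio `4 > 2` makes these annuli disjoint. -/
noncomputable def averagedBump (E : Type*) [NormedAddCommGroup E] [InnerProductSpace ℝ E]
    (N : ℕ) (s : ℝ) (x : E) : ℝ :=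
  (N : ℝ)⁻¹ * ∑ i ∈ Finset.range N, unitBump E ((s * 4 ^ i) • x)

theorem contDiff_averagedBump (N : ℕ) (s : ℝ) : ContDiff ℝ ∞ (averagedBump E N s) :=
  contDiff_const.mul (ContDiff.sum fun _ _ => contDiff_unitBump_smul _)

theorem averagedBump_mem_Icc (N : ℕ) (s : ℝ) (x : E) : averagedBump E N s x ∈ Icc 0 1 := by
  refine ⟨mul_nonneg (by positivity) (Finset.sum_nonneg fun _ _ => (unitBump E).nonneg), ?_⟩
  rcases N.eq_zero_or_pos with rfl | hN
  · simp [averagedBump]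
  · rw [averagedBump, inv_mul_le_one₀ (by positivity)]
    refine (Finset.sum_le_card_nsmul _ _ 1 fun _ _ => (unitBump E).le_one).trans ?_
    simp

theorem support_averagedBump_subset (N : ℕ) {s : ℝ} (hs : 0 < s) :
    Function.support (averagedBump E N s) ⊆ Metric.closedBall 0 (2 / s) := by
  intro x hx
  by_contra h
  refine hx ?_
  rw [averagedBump, Finset.sum_eq_zero, mul_zero]
  intro i _
  refine (unitBump E).zero_of_le_dist ?_
  have h1 : 2 < ‖x‖ * s := by simpa [div_lt_iff₀ hs] using h
  have h4 : (1 : ℝ) ≤ 4 ^ i := one_le_pow₀ (by norm_num)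
  rw [dist_zero_right, norm_smul, Real.norm_of_nonneg (by positivity)]
  change 2 ≤ _
  nlinarith

theorem averagedBump_eq_one {N : ℕ} (hN : 0 < N) {s : ℝ} (hs : 0 < s) {x : E}
    (hx : ‖x‖ ≤ (s * 4 ^ N)⁻¹) : averagedBump E N s x = 1 := by
  rw [averagedBump, Finset.sum_congr rfl (g := fun _ => (1 : ℝ))]
  · simp [hN.ne']
  intro i hi
  refine (unitBump E).one_of_mem_closedBall ?_
  rw [mem_closedBall_zero_iff, norm_smul, Real.norm_of_nonneg (by positivity)]
  change _ ≤ (1 : ℝ)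
  calc s * 4 ^ i * ‖x‖ ≤ s * 4 ^ N * (s * 4 ^ N)⁻¹ := by
        gcongr
        · norm_num
        · exact (Finset.mem_range.1 hi).le
    _ = 1 := mul_inv_cancel₀ (by positivity)

variable [MeasurableSpace E] [BorelSpace E] (μ : Measure E)

/-- The gradients of the averaged bumps have disjoint supports, so that their energies add up
without cross terms, and averaging gains a factor `N ^ (1 - p)`. -/
theorem lintegral_fderiv_averagedBump_le {p : ℝ} (hp : 1 < p) {C : ℝ≥0∞}
    (hC : ∀ s : ℝ, 1 ≤ s → ∫⁻ x, ‖fderiv ℝ (fun x : E => unitBump E (s • x)) x‖ₑ ^ p ∂μ ≤ C)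
    {N : ℕ} (hN : 0 < N) {s : ℝ} (hs : 1 ≤ s) :
    ∫⁻ x, ‖fderiv ℝ (averagedBump E N s) x‖ₑ ^ p ∂μ ≤
      ENNReal.ofReal ((N : ℝ) ^ (-(p - 1))) * C := by
  have hp0 : 0 < p := zero_lt_one.trans hp
  have hN' : (0 : ℝ) < N := by exact_mod_cast hN
  have hs0 : 0 < s := by linarith
  set g : ℕ → E → E →L[ℝ] ℝ := fun i => fderiv ℝ fun x : E => unitBump E ((s * 4 ^ i) • x)
    with hg
  have hgn : ∀ i x, g i x ≠ 0 → s * 4 ^ i * ‖x‖ ∈ Icc 1 2 := by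
    intro i x hx
    simp only [hg, fderiv_comp_smul] at hx
    have := norm_mem_Icc_of_fderiv_unitBump_ne_zero (right_ne_zero_of_smul hx)
    rwa [norm_smul, Real.norm_of_nonneg (by positivity)] at this
  have hlt : ∀ i j x, i < j → g i x ≠ 0 → g j x = 0 := by
    intro i j x hij hi
    by_contra hj
    have h1 := (hgn i x hi).1
    have h2 := (hgn j x hj).2
    have h3 : (4 : ℝ) * 4 ^ i ≤ 4 ^ j := by
      rw [← pow_succ']
      exact pow_le_pow_right₀ (by norm_num) hij
    have : s * (4 * 4 ^ i) * ‖x‖ ≤ s * 4 ^ j * ‖x‖ := by gcongr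
    linarith
  have hder : ∀ x, fderiv ℝ (averagedBump E N s) x =
      (N : ℝ)⁻¹ • ∑ i ∈ Finset.range N, g i x := by
    intro x
    have hd : ∀ i ∈ Finset.range N,
        DifferentiableAt ℝ (fun x : E => unitBump E ((s * 4 ^ i) • x)) x :=
      fun i _ => (contDiff_unitBump_smul _).differentiable (by simp) x
    change fderiv ℝ (fun x => (N : ℝ)⁻¹ * ∑ i ∈ Finset.range N, unitBump E ((s * 4 ^ i) • x)) x = _
    rw [fderiv_const_mul (DifferentiableAt.fun_sum hd), fderiv_fun_sum hd]
  have hpt : ∀ x, ‖fderiv ℝ (averagedBump E N s) x‖ₑ ^ p ≤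
      ENNReal.ofReal ((N : ℝ)⁻¹ ^ p) * ∑ i ∈ Finset.range N, ‖g i x‖ₑ ^ p := by
    intro x
    rw [hder, enorm_smul, ENNReal.mul_rpow_of_nonneg _ _ hp0.le,
      Real.enorm_of_nonneg (by positivity), ENNReal.ofReal_rpow_of_nonneg (by positivity) hp0.le]
    gcongr
    refine enorm_sum_rpow_le_of_subsingleton_ne_zero hp0 _ _ fun i _ j _ hi hj => ?_
    rcases lt_trichotomy i j with h | h | h
    · exact absurd (hlt i j x h hi) hj
    · exact h
    · exact absurd (hlt j i x h hj) hi
  have hmeas : ∀ i, Measurable fun x => ‖g i x‖ₑ ^ p := fun i =>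
    (measurable_fderiv ℝ _).enorm.pow_const p
  refine (lintegral_mono hpt).trans ?_
  rw [lintegral_const_mul _ (Finset.measurable_fun_sum _ fun i _ => hmeas i),
    lintegral_finsetSum _ fun i _ => hmeas i]
  calc ENNReal.ofReal ((N : ℝ)⁻¹ ^ p) * ∑ i ∈ Finset.range N, ∫⁻ x, ‖g i x‖ₑ ^ p ∂μ
      ≤ ENNReal.ofReal ((N : ℝ)⁻¹ ^ p) * ∑ i ∈ Finset.range N, C := by
        gcongr with i
        exact hC _ (one_le_mul_of_one_le_of_one_le hs (one_le_pow₀ (by norm_num)))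
    _ = ENNReal.ofReal ((N : ℝ) ^ (-(p - 1))) * C := by
        rw [Finset.sum_const, Finset.card_range, nsmul_eq_mul, ← mul_assoc,
          ← ENNReal.ofReal_natCast, ← ENNReal.ofReal_mul (by positivity), neg_sub,
          Real.rpow_sub hN', Real.rpow_one, Real.inv_rpow hN'.le, div_eq_inv_mul]

variable [μ.IsAddHaarMeasure]

/-- The `p`-energy of a bump function stays bounded when it is shrunk, as `p` is at most the
dimension. -/
theorem exists_lintegral_fderiv_unitBump_smul_le {p : ℝ} (hp : 1 < p)
    (hpd : p ≤ Module.finrank ℝ E) : ∃ C : ℝ≥0∞, C ≠ ⊤ ∧ ∀ s : ℝ, 1 ≤ s →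
      ∫⁻ x, ‖fderiv ℝ (fun x : E => unitBump E (s • x)) x‖ₑ ^ p ∂μ ≤ C := by
  have hp0 : 0 < p := zero_lt_one.trans hp
  obtain ⟨K, hK⟩ := ((unitBump E).hasCompactSupport.fderiv (𝕜 := ℝ)).exists_bound_of_continuous
    (((unitBump E).contDiff (n := 1)).continuous_fderiv (by simp))
  have hK0 : 0 ≤ K := (norm_nonneg _).trans (hK 0)
  refine ⟨ENNReal.ofReal (K ^ p * 2 ^ Module.finrank ℝ E) * μ (Metric.ball 0 1),
    ENNReal.mul_ne_top ENNReal.ofReal_ne_top measure_ball_lt_top.ne, fun s hs => ?_⟩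
  have hs0 : 0 < s := by linarith
  have hpt : ∀ x : E, ‖fderiv ℝ (fun x : E => unitBump E (s • x)) x‖ₑ ^ p ≤
      (Metric.closedBall (0 : E) (2 / s)).indicator
        (fun _ => ENNReal.ofReal ((s * K) ^ p)) x := by
    intro x
    rw [fderiv_comp_smul]
    by_cases hx : x ∈ Metric.closedBall (0 : E) (2 / s)
    · rw [indicator_of_mem hx, ← ENNReal.ofReal_rpow_of_nonneg (by positivity) hp0.le,
        ← ofReal_norm, norm_smul, Real.norm_of_nonneg hs0.le]
      gcongr
      exact hK _
    · have hz : fderiv ℝ (unitBump E) (s • x) = 0 := by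
        by_contra h
        refine hx ?_
        have := (norm_mem_Icc_of_fderiv_unitBump_ne_zero h).2
        rw [norm_smul, Real.norm_of_nonneg hs0.le] at this
        simpa [le_div_iff₀ hs0, mul_comm] using this
      rw [hz, smul_zero, ← ofReal_norm, norm_zero, ENNReal.ofReal_zero,
        ENNReal.zero_rpow_of_pos hp0]
      exact zero_le
  refine (lintegral_mono hpt).trans ?_
  rw [lintegral_indicator measurableSet_closedBall, setLIntegral_const,
    Measure.addHaar_closedBall μ _ (by positivity), ← mul_assoc,
    ← ENNReal.ofReal_mul (by positivity)]
  refine mul_le_mul_left (ENNReal.ofReal_le_ofReal ?_) _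
  have hsn : s ^ p ≤ s ^ Module.finrank ℝ E := by
    rw [← Real.rpow_natCast]
    exact Real.rpow_le_rpow_of_exponent_le hs hpd
  calc (s * K) ^ p * (2 / s) ^ Module.finrank ℝ E
      = s ^ p / s ^ Module.finrank ℝ E * (K ^ p * 2 ^ Module.finrank ℝ E) := by
        rw [Real.mul_rpow hs0.le hK0, div_pow]
        ring
    _ ≤ 1 * (K ^ p * 2 ^ Module.finrank ℝ E) := by
        gcongr
        exact (div_le_one (by positivity)).2 hsn
    _ = _ := one_mul _

/-- Points have zero `p`-capacity when `1 < p ≤ dim E`: there are smooth functions with arbitrarily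
small support and `W^{1,p}` norm that are equal to `1` near the origin. -/
theorem exists_cutoff_eLpNorm_le {p : ℝ} (hp : 1 < p) (hpd : p ≤ Module.finrank ℝ E)
    {ρ : ℝ} (hρ : 0 < ρ) {δ : ℝ≥0∞} (hδ : 0 < δ) :
    ∃ η : E → ℝ, ∃ r > 0, ContDiff ℝ ∞ η ∧ tsupport η ⊆ Metric.closedBall 0 ρ ∧
      (∀ x ∈ Metric.ball 0 r, η x = 1) ∧ eLpNorm η (ENNReal.ofReal p) μ ≤ δ ∧
        eLpNorm (fderiv ℝ η) (ENNReal.ofReal p) μ ≤ δ := by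
  have hp0 : 0 < p := zero_lt_one.trans hp
  have hn : Module.finrank ℝ E ≠ 0 := by
    intro h
    rw [h, Nat.cast_zero] at hpd
    linarith
  have hδp : 0 < δ ^ p := ENNReal.rpow_pos_of_nonneg hδ hp0.le
  -- A radius at which the whole ball has small measure.
  obtain ⟨R, hR0, hRρ, hRμ⟩ : ∃ R > 0, R ≤ ρ ∧ μ (Metric.closedBall (0 : E) R) ≤ δ ^ p := by
    have ht : Tendsto (fun R : ℝ => ENNReal.ofReal (R ^ Module.finrank ℝ E) *
        μ (Metric.ball (0 : E) 1)) (𝓝[>] 0) (𝓝 0) := by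
      have h1 : Tendsto (fun R : ℝ => ENNReal.ofReal (R ^ Module.finrank ℝ E)) (𝓝[>] 0) (𝓝 0) := by
        have hc : Continuous fun R : ℝ => ENNReal.ofReal (R ^ Module.finrank ℝ E) :=
          ENNReal.continuous_ofReal.comp (continuous_pow _)
        simpa [hn] using (hc.tendsto 0).mono_left (nhdsWithin_le_nhds (s := Ioi 0))
      simpa using ENNReal.Tendsto.mul_const h1 (Or.inr measure_ball_lt_top.ne)
    obtain ⟨R, hR, hRρ, hR0⟩ := ((ht.eventually_le_const hδp).and
      ((eventually_nhdsWithin_of_eventually_nhds (eventually_le_nhds hρ)).and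
        self_mem_nhdsWithin)).exists
    exact ⟨R, hR0, hRρ, by rwa [Measure.addHaar_closedBall μ _ (le_of_lt hR0)]⟩
  obtain ⟨C, hC, hCs⟩ := exists_lintegral_fderiv_unitBump_smul_le μ hp hpd
  obtain ⟨N, hNδ, hN⟩ : ∃ N : ℕ, ENNReal.ofReal ((N : ℝ) ^ (-(p - 1))) * C ≤ δ ^ p ∧ 0 < N := by
    have h1 : Tendsto (fun N : ℕ => ENNReal.ofReal ((N : ℝ) ^ (-(p - 1)))) atTop (𝓝 0) := by
      simpa using ENNReal.tendsto_ofReal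
        ((tendsto_rpow_neg_atTop (sub_pos.2 hp)).comp tendsto_natCast_atTop_atTop)
    have h2 : Tendsto (fun N : ℕ => ENNReal.ofReal ((N : ℝ) ^ (-(p - 1))) * C) atTop (𝓝 0) := by
      simpa using ENNReal.Tendsto.mul_const h1 (Or.inr hC)
    exact ((h2.eventually_le_const hδp).and (eventually_gt_atTop 0)).exists
  set s : ℝ := max 1 (2 / R) with hs
  have hs1 : 1 ≤ s := le_max_left _ _
  have hs0 : 0 < s := by linarith
  have hsR : 2 / s ≤ R := by
    rw [div_le_comm₀ hs0 hR0]
    exact le_max_right _ _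
  have hsupp : Function.support (averagedBump E N s) ⊆ Metric.closedBall 0 R :=
    (support_averagedBump_subset N hs0).trans (Metric.closedBall_subset_closedBall hsR)
  have hpt : ∀ x, ‖averagedBump E N s x‖ₑ ^ p ≤ (Metric.closedBall (0 : E) R).indicator 1 x := by
    intro x
    by_cases hx : x ∈ Metric.closedBall (0 : E) R
    · rw [indicator_of_mem hx]
      obtain ⟨h0, h1⟩ := averagedBump_mem_Icc N s x
      refine ENNReal.rpow_le_one ?_ hp0.le
      rw [Real.enorm_of_nonneg h0]
      exact ENNReal.ofReal_le_one.2 h1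
    · have hz : averagedBump E N s x = 0 := by_contra fun h => hx (hsupp h)
      rw [hz, enorm_zero, ENNReal.zero_rpow_of_pos hp0]
      exact zero_le
  refine ⟨averagedBump E N s, (s * 4 ^ N)⁻¹, by positivity, contDiff_averagedBump N s,
    ?_, ?_, ?_, ?_⟩
  · exact (closure_minimal hsupp Metric.isClosed_closedBall).trans
      (Metric.closedBall_subset_closedBall hRρ)
  · exact fun x hx => averagedBump_eq_one hN hs0 (by simpa using (mem_ball_zero_iff.1 hx).le)
  · refine eLpNorm_ofReal_le_of_lintegral_le hp0 ((lintegral_mono hpt).trans ?_)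
    rwa [lintegral_indicator_one measurableSet_closedBall]
  · exact eLpNorm_ofReal_le_of_lintegral_le hp0
      ((lintegral_fderiv_averagedBump_le μ hp hCs hN hs1).trans hNδ)

end Capacity

/-! ### Recovery sequences -/

section Recovery

variable {d : ℕ} {Ω : Set (EuclideanSpace ℝ (Fin d))} {p : ℝ} [hp : Fact (1 < p)]

/-- A test function `φ` can be given any value `t` near the origin by adding `(t - φ) η`, with `η` a
cutoff of small norm. -/
theorem IsTestFunction.exists_add_eq_near_zero (hpd : p ≤ d) (hopen : IsOpen Ω)
    (h0 : (0 : EuclideanSpace ℝ (Fin d)) ∈ Ω) {φ : EuclideanSpace ℝ (Fin d) → ℝ}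
    (hφ : IsTestFunction Ω φ) (t : ℝ) {δ : ℝ≥0∞} (hδ : 0 < δ) :
    ∃ h, IsTestFunction Ω h ∧ (∃ r > 0, Metric.ball 0 r ⊆ Ω ∧
      ∀ x ∈ Metric.ball 0 r, φ x + h x = t) ∧ eLpNorm h (ENNReal.ofReal p) volume ≤ δ ∧
        eLpNorm (∇ h) (ENNReal.ofReal p) volume ≤ δ := by
  obtain ⟨ρ, hρ, hρΩ⟩ := Metric.nhds_basis_closedBall.mem_iff.1 (hopen.mem_nhds h0)
  -- A bound for `t - φ` and its gradient.
  obtain ⟨M₁, hM₁⟩ := hφ.compact.exists_bound_of_continuous hφ.smooth.continuous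
  obtain ⟨M₂, hM₂⟩ := (hφ.compact.fderiv (𝕜 := ℝ)).exists_bound_of_continuous
    (hφ.smooth.continuous_fderiv (by simp))
  set M : ℝ := max (|t| + M₁) (max M₂ 1) with hM
  have hM1 : 1 ≤ M := (le_max_right _ _).trans (le_max_right _ _)
  have hM0 : 0 ≤ M := by linarith
  have hbound : ∀ x, ‖t - φ x‖ ≤ M := fun x =>
    ((norm_sub_le _ _).trans (add_le_add le_rfl (hM₁ x))).trans (le_max_left _ _)
  have hbound' : ∀ x, ‖fderiv ℝ φ x‖ ≤ M := fun x =>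
    (hM₂ x).trans ((le_max_left _ _).trans (le_max_right _ _))
  have hMpos : ENNReal.ofReal M ≠ 0 := by
    rw [Ne, ENNReal.ofReal_eq_zero]
    linarith
  set κ : ℝ≥0∞ := δ / 2 / ENNReal.ofReal M with hκ
  have hκ0 : 0 < κ := ENNReal.div_pos (ENNReal.half_pos hδ.ne').ne' ENNReal.ofReal_ne_top
  have hκM : ENNReal.ofReal M * κ = δ / 2 := ENNReal.mul_div_cancel hMpos ENNReal.ofReal_ne_top
  obtain ⟨η, r, hr, hη, hηs, hη1, hηκ, hηκ'⟩ := exists_cutoff_eLpNorm_le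
    (volume : Measure (EuclideanSpace ℝ (Fin d))) hp.out (by simpa using hpd) hρ hκ0
  have hts : tsupport (fun x => (t - φ x) * η x) ⊆ tsupport η :=
    closure_mono (Function.support_mul_subset_right _ _)
  refine ⟨fun x => (t - φ x) * η x, ⟨(contDiff_const.sub hφ.smooth).mul hη, ?_,
    (hts.trans hηs).trans hρΩ⟩, ⟨min r ρ, lt_min hr hρ, ?_, fun x hx => ?_⟩, ?_, ?_⟩
  · exact (isCompact_closedBall _ _).of_isClosed_subset (isClosed_tsupport _) (hts.trans hηs)
  · exact ((Metric.ball_subset_ball (min_le_right _ _)).trans Metric.ball_subset_closedBall).trans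
      hρΩ
  · simp [hη1 x (Metric.ball_subset_ball (min_le_left _ _) hx)]
  · refine (eLpNorm_le_mul_eLpNorm_of_ae_le_mul (g := η) (c := M)
      (Eventually.of_forall fun x => ?_) _).trans ?_
    · rw [norm_mul]
      gcongr
      exact hbound x
    · refine (mul_le_mul_right hηκ _).trans ?_
      rw [hκM]
      exact ENNReal.half_le_self
  · refine (eLpNorm_mono_real (g := fun x => M * ‖fderiv ℝ η x‖ + M * ‖η x‖) fun x => ?_).trans ?_
    · rw [gradient, LinearIsometryEquiv.norm_map, fderiv_fun_mul
        ((hφ.smooth.differentiable (by simp) x).const_sub t)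
        (hη.differentiable (by simp) x), fderiv_const_sub]
      refine (norm_add_le _ _).trans ?_
      rw [norm_smul, norm_smul, norm_neg, mul_comm ‖η x‖]
      gcongr
      · exact hbound x
      · exact hbound' x
    · have hm1 : AEStronglyMeasurable (fun x => M * ‖fderiv ℝ η x‖) volume :=
        (continuous_const.mul (hη.continuous_fderiv (by simp)).norm).aestronglyMeasurable
      have hm2 : AEStronglyMeasurable (fun x => M * ‖η x‖) volume :=
        (continuous_const.mul hη.continuous.norm).aestronglyMeasurable
      refine (eLpNorm_add_le hm1 hm2 Fact.out).trans ?_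
      rw [← ENNReal.add_halves δ, ← hκM]
      refine add_le_add ?_ ?_
      · refine (eLpNorm_le_mul_eLpNorm_of_ae_le_mul (g := fderiv ℝ η) (c := M)
          (Eventually.of_forall fun x => ?_) _).trans (mul_le_mul_right hηκ' _)
        simp [abs_of_nonneg hM0]
      · refine (eLpNorm_le_mul_eLpNorm_of_ae_le_mul (g := η) (c := M)
          (Eventually.of_forall fun x => ?_) _).trans (mul_le_mul_right hηκ _)
        simp [abs_of_nonneg hM0]

/-- By density of the test functions, near any `u ∈ W^{1,p}_0(Ω)` there are elements that are equal
to a given constant near the origin. -/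
theorem exists_edist_le_ae_eq_near_zero (hpd : p ≤ d) (hopen : IsOpen Ω)
    (h0 : (0 : EuclideanSpace ℝ (Fin d)) ∈ Ω) (u : SobolevZero Ω p) (t : ℝ) {δ : ℝ≥0∞}
    (hδ : 0 < δ) : ∃ w : SobolevZero Ω p, edist w u ≤ δ ∧ ∃ r > 0, Metric.ball 0 r ⊆ Ω ∧
      ∀ᵐ x ∂volume.restrict (Metric.ball 0 r), w.1.1 x = t := by
  have hδ2 := ENNReal.half_pos hδ.ne'
  obtain ⟨v, hv, huv⟩ := EMetric.mem_closure_iff.1 u.2 (δ / 2) hδ2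
  have hvφ := hv
  obtain ⟨φ, hφ, hv1, -⟩ := hvφ
  obtain ⟨h, hh, ⟨r, hr, hrΩ, hφh⟩, hδ1, hδ2⟩ := hφ.exists_add_eq_near_zero hpd hopen h0 t hδ2
  obtain ⟨z, hz1, hz2⟩ := SobolevZero.exists_of_isTestFunction (p := p) hh
  have hz1δ : ‖z.1.1‖ₑ ≤ δ / 2 := by
    rw [Lp.enorm_def, eLpNorm_congr_ae hz1]
    exact (eLpNorm_restrict_le _ _ _ _).trans hδ1
  have hz2δ : ‖z.1.2‖ₑ ≤ δ / 2 := by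
    rw [Lp.enorm_def, eLpNorm_congr_ae hz2]
    exact (eLpNorm_restrict_le _ _ _ _).trans hδ2
  refine ⟨⟨v + z.1, add_mem (Submodule.le_topologicalClosure _ hv) z.2⟩, ?_, r, hr, hrΩ, ?_⟩
  · rw [Subtype.edist_eq]
    refine (edist_triangle _ v _).trans ?_
    rw [← ENNReal.add_halves δ]
    refine add_le_add ?_ ?_
    · rw [edist_eq_enorm_sub, add_sub_cancel_left]
      exact max_le hz1δ hz2δ
    · rw [edist_comm]
      exact huv.le
  · filter_upwards [ae_restrict_of_ae_restrict_of_subset hrΩ (Lp.coeFn_add v.1 z.1.1),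
      ae_restrict_of_ae_restrict_of_subset hrΩ hv1, ae_restrict_of_ae_restrict_of_subset hrΩ hz1,
      ae_restrict_mem measurableSet_ball] with x hx hx1 hx2 hxr
    rw [Prod.fst_add, hx, Pi.add_apply, hx1, hx2, hφh x hxr]

variable [IsFiniteMeasure (volume.restrict Ω)]

/-- An element close to `u` in norm and equal to `m_p(u)` near the origin has nonlocal energies
eventually constant in `k` and close to the limit energy of `u`. -/
theorem exists_edist_le_eventually_nonlocalEnergy_le (hpd : p ≤ d) (hopen : IsOpen Ω)
    (h0 : (0 : EuclideanSpace ℝ (Fin d)) ∈ Ω) {ε : ℕ → ℝ} (hpos : ∀ k, 0 < ε k)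
    (hlim : Tendsto ε atTop (𝓝 0)) (u : SobolevZero Ω p) {δ : ℝ≥0∞} (hδ : 0 < δ) :
    ∃ w : SobolevZero Ω p, edist w u ≤ δ ∧
      ∀ᶠ k in atTop, nonlocalEnergy Ω p (ε k) w ≤ limitEnergy Ω p u + δ := by
  have hp0 : 0 < p := zero_lt_one.trans hp.out
  set t := pMean Ω p u.1.1
  let G : SobolevZero Ω p → ℝ≥0∞ := fun w => ENNReal.ofReal
    (‖w.1.1 - Lp.const (ENNReal.ofReal p) (volume.restrict Ω) t‖ ^ p + ‖w.1.2‖ ^ p)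
  have hG : Continuous G := by
    refine ENNReal.continuous_ofReal.comp (Continuous.add ?_ ?_)
    · exact (((continuous_fst.comp continuous_subtype_val).sub continuous_const).norm).rpow_const
        fun _ => Or.inr hp0.le
    · exact ((continuous_snd.comp continuous_subtype_val).norm).rpow_const
        fun _ => Or.inr hp0.le
  have hGu : G u = limitEnergy Ω p u := (limitEnergy_eq_ofReal u).symm
  have hev : ∀ᶠ w in 𝓝 u, G w ≤ limitEnergy Ω p u + δ := by
    refine (hG.tendsto u).eventually_le_const ?_
    rw [hGu]
    exact ENNReal.lt_add_right (hGu ▸ ENNReal.ofReal_ne_top) hδ.ne'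
  obtain ⟨κ, hκ, hball⟩ := Metric.nhds_basis_closedEBall.mem_iff.1 hev
  obtain ⟨w, hwu, r, hr, hrΩ, hw⟩ :=
    exists_edist_le_ae_eq_near_zero hpd hopen h0 u t (lt_min hκ hδ)
  refine ⟨w, hwu.trans (min_le_right _ _), ?_⟩
  filter_upwards [hlim.eventually_le_const hr] with k hk
  rw [nonlocalEnergy_eq_of_ae_eq (hpos k) hk hrΩ hw]
  exact hball (hwu.trans (min_le_left _ _))

end Recovery

theorem mainTheorem4 (d : ℕ) (p : ℝ) [Fact (1 < p)] (hpd : p ≤ d)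
    (Ω : Set (EuclideanSpace ℝ (Fin d))) (hopen : IsOpen Ω) (hconn : IsConnected Ω)
    (hbdd : Bornology.IsBounded Ω) (h0 : (0 : EuclideanSpace ℝ (Fin d)) ∈ Ω)
    (ε : ℕ → ℝ) (hpos : ∀ k, 0 < ε k) (hlim : Tendsto ε atTop (𝓝 0)) :
    (∀ (u : Lp ℝ (ENNReal.ofReal p) (volume.restrict Ω)) (t : ℝ),
      IsPMean Ω p u t ↔ t = pMean Ω p u) ∧
    IsGammaLimit (X := WeakSpace ℝ (SobolevZero Ω p))
      (fun k u => nonlocalEnergy Ω p (ε k) ((toWeakSpace ℝ (SobolevZero Ω p)).symm u))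
      (fun u => limitEnergy Ω p ((toWeakSpace ℝ (SobolevZero Ω p)).symm u)) ∧
    IsSeqGammaLimit (X := WeakSpace ℝ (SobolevZero Ω p))
      (fun k u => nonlocalEnergy Ω p (ε k) ((toWeakSpace ℝ (SobolevZero Ω p)).symm u))
      (fun u => limitEnergy Ω p ((toWeakSpace ℝ (SobolevZero Ω p)).symm u)) := by
  have hfin : IsFiniteMeasure (volume.restrict Ω) :=
    isFiniteMeasure_restrict.2 hbdd.measure_lt_top.ne
  have hne : NeZero (volume.restrict Ω) :=
    ⟨fun h => (hopen.measure_pos volume ⟨0, h0⟩).ne' (Measure.restrict_eq_zero.1 h)⟩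
  exact ⟨isPMean_iff_eq_pMean, isGammaLimit_and_isSeqGammaLimit_weakSpace
    (F := fun k => nonlocalEnergy Ω p (ε k)) (G := limitEnergy Ω p)
    lowerSemicontinuous_limitEnergy
    (fun k => limitEnergy_le_nonlocalEnergy hopen.measurableSet (hpos k))
    fun u δ hδ => exists_edist_le_eventually_nonlocalEnergy_le hpd hopen h0 hpos hlim u hδ⟩
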